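/- Let $p, N \in \mathbb N$ with $N \ge 2$, let $s = (s_n)_{n\ge 1}$ be positive reals with $\sum_n s_n < \infty$, and for each $n$ let $\mathcal D^n \subset \mathbb R^p$ be a set of exactly $N$ points that contains $0$. For such data put $$C_{s,\mathcal D} = \Big\{ \sum_{i=1}^\infty s_i b_i : b_i \in \mathcal D^i \Big\}.$$ Let $\kappa_n$ and $\tau_n$ be the maximum and the minimum of $\|d-d'\|$ over distinct $d,d' \in \mathcal D^n$, let $\kappa = \sup_n \kappa_n$, $\tau = \inf_n \tau_n$ and $R_n = \sum_{i>n} s_i$, and assume that $\kappa<\infty$, $\tau>0$ and $$\sup_n \frac{\kappa R_n}{\tau s_n} < 1 .$$ Suppose that $\dim_H C_{s,\mathcal D} = A$ and $\dim_P C_{s,\mathcal D} = B$ (Hausdorff and packing dimension). Then for all $0 \le \alpha \le A$ and $0 \le \beta \le B$ with $\alpha/A \le \beta/B$ (where $0/0$ is read as $0$), there is a subsequence $t = (t_n) = (s_{\varphi(n)})$ of $(s_n)$, with $\varphi$ strictly increasing, such that $\dim_H C_{t,\mathcal D} = \alpha$ and $\dim_P C_{t,\mathcal D} = \beta$. For the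 same $\varphi$ this also holds when each retained term keeps its own digit set, that is, for the subset $\{ \sum_i s_{\varphi(i)} b_i : b_i \in \mathcal D^{\varphi(i)} \}$ of $C_{s,\mathcal D}$: it too has Hausdorff dimension $\alpha$ and packing dimension $\beta$. -/

import Mathlib

open scoped ENNReal NNReal

noncomputable section

section Packing

variable {X : Type*} [MetricSpace X]

/-- `V` is a `δ`-packing of `E`: a disjoint family of open balls, given by their pairs
(centre, radius), with centres in `E` and positive radii at most `δ`. -/
def IsPacking (δ : ℝ) (E : Set X) (V : Set (X × ℝ)) : Prop :=
  (∀ q ∈ V, q.1 ∈ E ∧ 0 < q.2 ∧ q.2 ≤ δ) ∧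
    V.PairwiseDisjoint (fun q => Metric.ball q.1 q.2)

/-- The supremum of the sums `∑ h(|B|)` over all `δ`-packings of `E`, where `|B|` is the
diameter of the ball `B`. -/
def packingDelta (h : ℝ≥0∞ → ℝ≥0∞) (δ : ℝ) (E : Set X) : ℝ≥0∞ :=
  ⨆ (V : Set (X × ℝ)) (_ : IsPacking δ E V),
    ∑' q : V, h (Metric.ediam (Metric.ball q.1.1 q.1.2))

/-- The `h`-packing premeasure: the limit as `δ → 0+` of the quantity above, which is monotone
in `δ`, so that the limit is an infimum. -/
def packingPremeasure (h : ℝ≥0∞ → ℝ≥0∞) (E : Set X) : ℝ≥0∞ :=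
  ⨅ (δ : ℝ) (_ : 0 < δ), packingDelta h δ E

/-- The `h`-packing measure: the infimum of `∑ i, P₀(U i)` over countable covers of `E`. -/
def packingMeasure (h : ℝ≥0∞ → ℝ≥0∞) (E : Set X) : ℝ≥0∞ :=
  ⨅ (U : ℕ → Set X) (_ : E ⊆ ⋃ i, U i), ∑' i, packingPremeasure h (U i)

/-- The packing dimension: the supremum of the `d ≥ 0` for which the packing measure of `E` for
`h(x) = x ^ d` is infinite (compare `dimH`). -/
def packingDim (E : Set X) : ℝ≥0∞ :=
  ⨆ (d : ℝ≥0) (_ : packingMeasure (fun x => x ^ (d : ℝ)) E = ∞), (d : ℝ≥0∞)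

end Packing

section SumSet

variable {p : ℕ}

/-- The generalized sum set `{∑ i, s i • b i : b i ∈ D i}`. -/
def sumSet (s : ℕ → ℝ) (D : ℕ → Finset (EuclideanSpace ℝ (Fin p))) :
    Set (EuclideanSpace ℝ (Fin p)) :=
  {x | ∃ b : ℕ → EuclideanSpace ℝ (Fin p), (∀ i, b i ∈ D i) ∧ HasSum (fun i => s i • b i) x}

/-- The (finite) set of distances between distinct elements of a digit set. -/
def digitDists (F : Finset (EuclideanSpace ℝ (Fin p))) : Set ℝ :=
  {r | ∃ x ∈ F, ∃ y ∈ F, x ≠ y ∧ r = ‖x - y‖}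

/-- The largest distance between distinct digits. -/
def kappaDigit (F : Finset (EuclideanSpace ℝ (Fin p))) : ℝ := sSup (digitDists F)

/-- The smallest distance between distinct digits. -/
def tauDigit (F : Finset (EuclideanSpace ℝ (Fin p))) : ℝ := sInf (digitDists F)

/-- `κ = sup_n κ_n`. -/
def kappa (D : ℕ → Finset (EuclideanSpace ℝ (Fin p))) : ℝ := ⨆ n, kappaDigit (D n)

/-- `τ = inf_n τ_n`. -/
def tau (D : ℕ → Finset (EuclideanSpace ℝ (Fin p))) : ℝ := ⨅ n, tauDigit (D n)

end SumSet

/-- The tail `R_n = ∑_{i > n} s_i`. -/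
def tailSum (s : ℕ → ℝ) (n : ℕ) : ℝ := ∑' i, s (n + 1 + i)

/-- The standing assumptions on `s` and `D`: the scaling factors are positive and summable, the
digit sets have `N ≥ 2` elements, one of which is `0`, the constants satisfy `κ < ∞` and `τ > 0`,
and the rapid decay condition `sup_n κ R_n / (τ s_n) < 1` holds. -/
structure IsSumSetData {p : ℕ} (N : ℕ) (s : ℕ → ℝ)
    (D : ℕ → Finset (EuclideanSpace ℝ (Fin p))) : Prop where
  two_le : 2 ≤ N
  pos : ∀ n, 0 < s n
  summable : Summable s
  card_eq : ∀ n, (D n).card = N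
  zero_mem : ∀ n, (0 : EuclideanSpace ℝ (Fin p)) ∈ D n
  kappa_finite : BddAbove (Set.range fun n => kappaDigit (D n))
  tau_pos : 0 < tau D
  decay : ∃ M : ℝ, M < 1 ∧ ∀ n, kappa D * tailSum s n / (tau D * s n) ≤ M

end

open Filter Set MeasureTheory Topology

/-! Write `e n = n log N / (-log (s n))`. Rapid decay makes the sum set a Cantor set coded by digit
sequences: points whose codes first differ at index `n` lie at distance comparable to `s n`.
Covering, Hölder and packing arguments then give Hausdorff dimension `liminf e` and packing
dimension `limsup e` (`IsCantorCoding.dimH_range`, `IsCantorCoding.packingDim_range`). The digit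
sets enter only through uniform constants, which survive passing to a subsequence of `s` with any
reassignment of digit sets (`HasSeparatedDigits.comp`). Both claims thus reduce to one statement
about numbers.

Along a subsequence `s ∘ φ` the exponent at `k` is `(k / φ k) * e (φ k)`: the old exponent times the
density of retained indices below `φ k`. With `a = α / A` and `b = β / B`, so that `a ≤ b ≤ 1`,
retain a set of indices whose densities lie asymptotically in `[a, b]`, tend to `a` along scales
where `e` approaches its liminf `A`, and tend to `b` along scales where `e` approaches its limsup
`B`. The product bounds give liminf at least `a * A = α` and limsup at most `b * B = β`, and the two
families of scales show equality (`exists_strictMono_liminf_limsup_scaleExponent`). The set is built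
from a local density alternating between `a` and `b` on rapidly growing blocks that end at those
scales (`exists_enumeration_of_two_densities`). -/

/-- The exponent at level `n` of a Cantor set with `N ^ n` pieces of size about `s n`. -/
noncomputable def scaleExponent (N : ℕ) (s : ℕ → ℝ) (n : ℕ) : ℝ≥0∞ :=
  ENNReal.ofReal (n * Real.log N / (-Real.log (s n)))

theorem pow_mul_rpow_eq_exp {N : ℕ} (hN : 2 ≤ N) {x : ℝ} (hx : 0 < x) (n : ℕ) (d : ℝ) :
    (N : ℝ) ^ n * x ^ d = Real.exp (n * Real.log N - d * -Real.log x) := by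
  have hN0 : (0 : ℝ) < N := by positivity
  rw [Real.rpow_def_of_pos hx, ← Real.rpow_natCast, Real.rpow_def_of_pos hN0, ← Real.exp_add]
  congr 1
  ring

/-- Taking logarithms turns a bound on the exponent into a bound on the level-`n` sum of `N ^ n`
pieces of size `s n`; `s n < 1` fixes the sign of the denominator. -/
theorem pow_mul_rpow_le_one_of_scaleExponent_lt {N : ℕ} (hN : 2 ≤ N) {s : ℕ → ℝ} {n : ℕ}
    (h0 : 0 < s n) (h1 : s n < 1) {d : ℝ≥0} (h : scaleExponent N s n < d) :
    (N : ℝ) ^ n * s n ^ (d : ℝ) ≤ 1 := by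
  have hl : 0 < -Real.log (s n) := neg_pos.2 (Real.log_neg h0 h1)
  have hN1 : (1 : ℝ) ≤ N := by exact_mod_cast (by omega : 1 ≤ N)
  have hN' : 0 ≤ Real.log N := Real.log_nonneg hN1
  rw [scaleExponent, ENNReal.ofReal_lt_coe_iff (by positivity), div_lt_iff₀ hl] at h
  rw [pow_mul_rpow_eq_exp hN h0, Real.exp_le_one_iff]
  linarith

theorem one_le_pow_mul_rpow_of_lt_scaleExponent {N : ℕ} (hN : 2 ≤ N) {s : ℕ → ℝ} {n : ℕ}
    (h0 : 0 < s n) (h1 : s n < 1) {d : ℝ≥0} (h : d < scaleExponent N s n) :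
    1 ≤ (N : ℝ) ^ n * s n ^ (d : ℝ) := by
  have hl : 0 < -Real.log (s n) := neg_pos.2 (Real.log_neg h0 h1)
  rw [scaleExponent, ENNReal.lt_ofReal_iff_toReal_lt ENNReal.coe_ne_top, ENNReal.coe_toReal,
    lt_div_iff₀ hl] at h
  rw [pow_mul_rpow_eq_exp hN h0, Real.one_le_exp_iff]
  linarith

/-! ### Coded Cantor sets and their Hausdorff dimension -/

/-- `π` codes a Cantor set by sequences in `Fin N`: the distance of two points is comparable to
`s n`, where `n` is the first index at which their codes differ. -/
structure IsCantorCoding {X : Type*} [MetricSpace X] (N : ℕ) (s : ℕ → ℝ)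
    (π : (ℕ → Fin N) → X) (c C : ℝ) : Prop where
  two_le : 2 ≤ N
  pos : ∀ n, 0 < s n
  anti : Antitone s
  tendsto : Tendsto s atTop (𝓝 0)
  c_pos : 0 < c
  C_pos : 0 < C
  dist_le : ∀ n w w', w' ∈ PiNat.cylinder w n → dist (π w) (π w') ≤ C * s n
  le_dist : ∀ n w w', w n ≠ w' n → c * s n ≤ dist (π w) (π w')

namespace IsCantorCoding

variable {X : Type*} [MetricSpace X] {N : ℕ} {s : ℕ → ℝ} {π : (ℕ → Fin N) → X} {c C : ℝ}

theorem nonempty (h : IsCantorCoding N s π c C) : Nonempty (ℕ → Fin N) :=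
  ⟨fun _ => ⟨0, by have := h.two_le; omega⟩⟩

theorem eventually_lt_one (h : IsCantorCoding N s π c C) : ∀ᶠ n in atTop, s n < 1 :=
  h.tendsto.eventually_lt_const one_pos

theorem injective (h : IsCantorCoding N s π c C) : Function.Injective π := by
  intro w w' hw
  funext n
  by_contra hn
  have h1 := h.le_dist n w w' hn
  rw [hw, dist_self] at h1
  exact absurd h1 (not_le.2 (mul_pos h.c_pos (h.pos n)))

theorem continuous (h : IsCantorCoding N s π c C) : Continuous π := by
  rw [continuous_iff_continuousAt]
  intro w
  rw [ContinuousAt, Metric.tendsto_nhds]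
  intro ε hε
  have h1 : Tendsto (fun n => C * s n) atTop (𝓝 0) := by simpa using h.tendsto.const_mul C
  obtain ⟨n, hn⟩ := (h1.eventually_lt_const hε).exists
  filter_upwards [(PiNat.isOpen_cylinder (fun _ => Fin N) w n).mem_nhds
    (PiNat.self_mem_cylinder w n)] with w' hw'
  rw [dist_comm]
  exact (h.dist_le n w w' hw').trans_lt hn

section Hausdorff

variable [MeasurableSpace X] [BorelSpace X]

/-- The `N ^ n` cylinders of length `n` cover the set by pieces of diameter at most `C * s n`, and
at infinitely many levels their `d`-sum is at most `C ^ d`. -/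
theorem hausdorffMeasure_range_ne_top (h : IsCantorCoding N s π c C) {d : ℝ≥0}
    (hd : liminf (scaleExponent N s) atTop < d) : μH[d] (range π) ≠ ∞ := by
  set S : Set ℕ := {n | scaleExponent N s n < d ∧ s n < 1}
  have hfr : ∃ᶠ n in atTop, n ∈ S :=
    (frequently_lt_of_liminf_lt (by isBoundedDefault) hd).and_eventually h.eventually_lt_one
  -- The covering bound holds only at levels in `S`, so limits are taken along `atTop` restricted to
  -- `S`.
  have : NeBot (atTop ⊓ 𝓟 S) := frequently_mem_iff_neBot.1 hfr
  have hmem : ∀ᶠ n in atTop ⊓ 𝓟 S, n ∈ S := mem_inf_of_right (mem_principal_self S)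
  have hr : Tendsto (fun n => ENNReal.ofReal (C * s n)) (atTop ⊓ 𝓟 S) (𝓝 0) := by
    have h1 : Tendsto (fun n => C * s n) atTop (𝓝 0) := by simpa using h.tendsto.const_mul C
    simpa using (ENNReal.tendsto_ofReal h1).mono_left inf_le_left
  have hdiam : ∀ n (v : Fin n → Fin N),
      Metric.ediam (π '' {w | ∀ i : Fin n, w i = v i}) ≤ ENNReal.ofReal (C * s n) := by
    intro n v
    refine Metric.ediam_le_of_forall_dist_le ?_
    rintro _ ⟨w, hw, rfl⟩ _ ⟨w', hw', rfl⟩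
    exact h.dist_le n w w' fun i hi => (hw' ⟨i, hi⟩).trans (hw ⟨i, hi⟩).symm
  have key := Measure.hausdorffMeasure_le_liminf_sum (ι := fun n => Fin n → Fin N) (d : ℝ)
    (range π) _ hr (fun n v => π '' {w | ∀ i : Fin n, w i = v i})
    (Eventually.of_forall hdiam) (Eventually.of_forall fun n => by
      rintro _ ⟨w, rfl⟩
      exact mem_iUnion.2 ⟨fun i => w i, w, fun _ => rfl, rfl⟩)
  have hle : liminf (fun n => ∑ v : Fin n → Fin N,
      Metric.ediam (π '' {w | ∀ i : Fin n, w i = v i}) ^ (d : ℝ)) (atTop ⊓ 𝓟 S)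
      ≤ ENNReal.ofReal (C ^ (d : ℝ)) := by
    refine liminf_le_of_frequently_le (Eventually.frequently ?_) (by isBoundedDefault)
    filter_upwards [hmem] with n hn
    calc ∑ v : Fin n → Fin N, Metric.ediam (π '' {w | ∀ i : Fin n, w i = v i}) ^ (d : ℝ)
        ≤ ∑ _v : Fin n → Fin N, ENNReal.ofReal (C * s n) ^ (d : ℝ) :=
          Finset.sum_le_sum fun v _ => ENNReal.rpow_le_rpow (hdiam n v) d.coe_nonneg
      _ = ENNReal.ofReal (C ^ (d : ℝ) * ((N : ℝ) ^ n * s n ^ (d : ℝ))) := by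
          have hN : (N : ℝ≥0∞) = ENNReal.ofReal N := by simp
          simp only [Finset.sum_const, Finset.card_univ, Fintype.card_fun, Fintype.card_fin,
            nsmul_eq_mul, Nat.cast_pow]
          rw [ENNReal.ofReal_rpow_of_nonneg (mul_pos h.C_pos (h.pos n)).le d.coe_nonneg, hN,
            ← ENNReal.ofReal_pow (by positivity), ← ENNReal.ofReal_mul (by positivity),
            Real.mul_rpow h.C_pos.le (h.pos n).le]
          congr 1
          ring
      _ ≤ ENNReal.ofReal (C ^ (d : ℝ)) := by
          refine ENNReal.ofReal_le_ofReal (mul_le_of_le_one_right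
            (Real.rpow_nonneg h.C_pos.le _) ?_)
          exact pow_mul_rpow_le_one_of_scaleExponent_lt h.two_le (h.pos n) hn.2 hn.1
  exact ((key.trans hle).trans_lt ENNReal.ofReal_lt_top).ne

end Hausdorff

theorem dimH_range_le (h : IsCantorCoding N s π c C) :
    dimH (range π) ≤ liminf (scaleExponent N s) atTop := by
  borelize X
  by_contra! hlt
  obtain ⟨d, hd1, hd2⟩ := ENNReal.lt_iff_exists_nnreal_btwn.1 hlt
  exact hd2.not_ge (dimH_le_of_hausdorffMeasure_ne_top (h.hausdorffMeasure_range_ne_top hd1))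

theorem exists_pow_inv_le (h : IsCantorCoding N s π c C) {d : ℝ≥0}
    (hd : d < liminf (scaleExponent N s) atTop) :
    ∃ K : ℝ, 0 < K ∧ ∀ n, ((N : ℝ) ^ n)⁻¹ ≤ K * s n ^ (d : ℝ) := by
  have hN0 : (1 : ℝ) ≤ N := by exact_mod_cast one_le_two.trans h.two_le
  obtain ⟨n₀, hn₀⟩ := eventually_atTop.1
    ((eventually_lt_of_lt_liminf hd).and h.eventually_lt_one)
  refine ⟨max 1 (s n₀ ^ (d : ℝ))⁻¹, by positivity, fun n => ?_⟩
  have hs : 0 < s n ^ (d : ℝ) := Real.rpow_pos_of_pos (h.pos n) _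
  rcases le_total n₀ n with hn | hn
  · have h1 := one_le_pow_mul_rpow_of_lt_scaleExponent h.two_le (h.pos n) (hn₀ n hn).2 (hn₀ n hn).1
    calc ((N : ℝ) ^ n)⁻¹ ≤ 1 * s n ^ (d : ℝ) := by
          rw [inv_le_iff_one_le_mul₀ (by positivity)]; linarith
      _ ≤ _ := by gcongr; exact le_max_left _ _
  · have hs0 : 0 < s n₀ ^ (d : ℝ) := Real.rpow_pos_of_pos (h.pos n₀) _
    calc ((N : ℝ) ^ n)⁻¹ ≤ 1 := inv_le_one_of_one_le₀ (one_le_pow₀ hN0)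
      _ = (s n₀ ^ (d : ℝ))⁻¹ * s n₀ ^ (d : ℝ) := (inv_mul_cancel₀ hs0.ne').symm
      _ ≤ _ := by
        gcongr
        · exact le_max_right _ _
        · exact (h.pos n₀).le
        · exact h.anti hn

/-- Reading codes as base-`N` expansions maps the set onto `[0, 1]`. For `d` below the liminf this
map is `d`-Hölder, by `exists_pow_inv_le`, so `1 ≤ dimH / d`. -/
theorem le_dimH_range (h : IsCantorCoding N s π c C) :
    liminf (scaleExponent N s) atTop ≤ dimH (range π) := by
  have hN : 1 < N := h.two_le
  have := h.nonempty
  refine ENNReal.le_of_forall_nnreal_lt fun d hd => ?_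
  rcases eq_or_ne d 0 with rfl | hd0
  · simp
  obtain ⟨K, hK, hKn⟩ := h.exists_pow_inv_le hd
  have hd' : 0 < d := pos_iff_ne_zero.2 hd0
  have hleft := Function.leftInverse_invFun h.injective
  have hold : HolderOnWith (Real.toNNReal (K / c ^ (d : ℝ))) d
      (fun x => Real.ofDigits (Function.invFun π x)) (range π) := by
    rintro _ ⟨w, rfl⟩ _ ⟨w', rfl⟩
    simp only [hleft w, hleft w']
    rcases eq_or_ne w w' with rfl | hne
    · simp
    set n := PiNat.firstDiff w w'
    have h1 : dist (Real.ofDigits w) (Real.ofDigits w') ≤ ((N : ℝ) ^ n)⁻¹ :=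
      Real.abs_ofDigits_sub_ofDigits_le fun i hi => PiNat.apply_eq_of_lt_firstDiff hi
    have h2 := h.le_dist n w w' (PiNat.apply_firstDiff_ne hne)
    have h3 : dist (Real.ofDigits w) (Real.ofDigits w')
        ≤ K / c ^ (d : ℝ) * dist (π w) (π w') ^ (d : ℝ) := by
      have hc : 0 < c ^ (d : ℝ) := Real.rpow_pos_of_pos h.c_pos _
      have h4 : (c * s n) ^ (d : ℝ) ≤ dist (π w) (π w') ^ (d : ℝ) :=
        Real.rpow_le_rpow (mul_pos h.c_pos (h.pos n)).le h2 d.coe_nonneg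
      rw [Real.mul_rpow h.c_pos.le (h.pos n).le] at h4
      calc _ ≤ K * s n ^ (d : ℝ) := h1.trans (hKn n)
        _ = K / c ^ (d : ℝ) * (c ^ (d : ℝ) * s n ^ (d : ℝ)) := by field_simp
        _ ≤ _ := by gcongr
    rw [edist_dist, edist_dist, ENNReal.ofReal_rpow_of_nonneg dist_nonneg d.coe_nonneg]
    refine (ENNReal.ofReal_le_ofReal h3).trans_eq ?_
    rw [ENNReal.ofReal_mul (div_nonneg hK.le (Real.rpow_nonneg h.c_pos.le _))]
    rfl
  have h1 := hold.dimH_image_le hd'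
  have h2 : Icc (0 : ℝ) 1 ⊆ (fun x => Real.ofDigits (Function.invFun π x)) '' range π := by
    intro x hx
    obtain ⟨w, -, rfl⟩ := Real.ofDigits_SurjOn hN hx
    exact ⟨π w, mem_range_self w, by simp only [hleft w]⟩
  have h3 : dimH (Icc (0 : ℝ) 1) = 1 := by
    rw [Real.dimH_of_nonempty_interior (by simp)]
    simp
  have h4 : 1 ≤ dimH (range π) / d := h3 ▸ (dimH_mono h2).trans h1
  rwa [ENNReal.le_div_iff_mul_le (Or.inl (by simpa using hd0)) (Or.inl ENNReal.coe_ne_top),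
    one_mul] at h4

theorem dimH_range (h : IsCantorCoding N s π c C) :
    dimH (range π) = liminf (scaleExponent N s) atTop :=
  h.dimH_range_le.antisymm h.le_dimH_range

end IsCantorCoding

/-! ### Packing dimension of coded Cantor sets -/

/-- **Kraft's inequality** for a disjoint family of cylinders. -/
theorem tsum_pow_inv_le_one_of_disjoint_cylinders {N : ℕ} (hN : 0 < N) {ι : Type*}
    (w : ι → ℕ → Fin N) (m : ι → ℕ)
    (hdisj : Pairwise fun i j => Disjoint (PiNat.cylinder (w i) (m i))
      (PiNat.cylinder (w j) (m j))) :
    ∑' i, ((N : ℝ≥0∞)⁻¹) ^ m i ≤ 1 := by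
  have : Nonempty (Fin N) := ⟨⟨0, hN⟩⟩
  -- Under the uniform product measure a cylinder of length `m` has mass `N⁻¹ ^ m`.
  set ν : Measure (Fin N) := (PMF.uniformOfFintype (Fin N)).toMeasure
  have hν : ∀ a : Fin N, ν {a} = (N : ℝ≥0∞)⁻¹ := fun a => by
    simp [ν]
  set μ : Measure (ℕ → Fin N) := Measure.infinitePi fun _ => ν
  have hμ : ∀ (x : ℕ → Fin N) n, μ (PiNat.cylinder x n) = ((N : ℝ≥0∞)⁻¹) ^ n := fun x n => by
    rw [PiNat.cylinder_eq_pi, Measure.infinitePi_pi _ fun _ _ => measurableSet_singleton _]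
    simp [hν]
  calc ∑' i, ((N : ℝ≥0∞)⁻¹) ^ m i = ∑' i, μ (PiNat.cylinder (w i) (m i)) := by simp only [hμ]
    _ ≤ μ (⋃ i, PiNat.cylinder (w i) (m i)) := by
        refine tsum_meas_le_meas_iUnion_of_disjoint μ (fun i => ?_) hdisj
        rw [PiNat.cylinder_eq_pi]
        exact MeasurableSet.pi (Finset.range (m i)).countable_toSet
          fun _ _ => measurableSet_singleton _
    _ ≤ 1 := prob_le_one

theorem packingDelta_empty {X : Type*} [MetricSpace X] (f : ℝ≥0∞ → ℝ≥0∞) (δ : ℝ) :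
    packingDelta f δ (∅ : Set X) = 0 := by
  simp only [packingDelta, ENNReal.iSup_eq_zero]
  intro V hV
  have : V = ∅ := eq_empty_of_forall_notMem fun q hq => (hV.1 q hq).1
  subst this
  simp

theorem packingMeasure_le_packingDelta {X : Type*} [MetricSpace X] (f : ℝ≥0∞ → ℝ≥0∞) {δ : ℝ}
    (hδ : 0 < δ) (E : Set X) : packingMeasure f E ≤ packingDelta f δ E := by
  refine (iInf₂_le (fun n : ℕ => if n = 0 then E else ∅)
    fun x hx => mem_iUnion.2 ⟨0, by simpa using hx⟩).trans ?_
  rw [tsum_eq_single 0]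
  · exact iInf₂_le (f := fun (δ : ℝ) (_ : 0 < δ) => packingDelta f δ E) δ hδ
  · intro n hn
    simp only [if_neg hn]
    exact le_antisymm ((iInf₂_le 1 one_pos).trans (packingDelta_empty f 1).le) bot_le

theorem ediam_ball_le {X : Type*} [MetricSpace X] (x : X) (r : ℝ) :
    Metric.ediam (Metric.ball x r) ≤ ENNReal.ofReal (2 * r) := by
  rw [← Metric.eball_ofReal, ENNReal.ofReal_mul two_pos.le]
  simpa using Metric.ediam_eball_le (x := x) (r := ENNReal.ofReal r)

theorem ofReal_le_ediam_ball {E : Type*} [NormedAddCommGroup E] [NormedSpace ℝ E] [Nontrivial E]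
    (x : E) {r : ℝ} (hr : 0 ≤ r) :
    ENNReal.ofReal (2 * r) ≤ Metric.ediam (Metric.ball x r) := by
  rw [← Metric.diam_ball_eq x hr]
  exact ENNReal.ofReal_toReal_le

namespace IsCantorCoding

section MetricSpace

variable {X : Type*} [MetricSpace X] {N : ℕ} {s : ℕ → ℝ} {π : (ℕ → Fin N) → X} {c C : ℝ}

theorem exists_level (h : IsCantorCoding N s π c C) {n₀ : ℕ} {r : ℝ} (hr : 0 < r)
    (hrn : r ≤ C * s n₀) : ∃ n, n₀ ≤ n ∧ C * s (n + 1) < r ∧ r ≤ C * s n := by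
  have h1 : Tendsto (fun n => C * s n) atTop (𝓝 0) := by simpa using h.tendsto.const_mul C
  have hex : ∃ m, C * s m < r := (h1.eventually_lt_const hr).exists
  classical
  obtain ⟨n, hn⟩ : ∃ n, Nat.find hex = n + 1 := by
    refine Nat.exists_eq_succ_of_ne_zero fun h0 => ?_
    have h2 := Nat.find_spec hex
    rw [h0] at h2
    have := mul_le_mul_of_nonneg_left (h.anti (Nat.zero_le n₀)) h.C_pos.le
    linarith
  refine ⟨n, ?_, hn ▸ Nat.find_spec hex, not_lt.1 (Nat.find_min hex (by omega))⟩
  by_contra! hlt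
  have h2 := Nat.find_spec hex
  rw [hn] at h2
  have := mul_le_mul_of_nonneg_left (h.anti (Nat.succ_le_of_lt hlt)) h.C_pos.le
  exact absurd (hrn.trans this) (not_le.2 h2)

/-- A centred ball of radius between `C * s (n + 1)` and `C * s n` contains the image of a cylinder
of length `n + 1`. Disjoint balls give disjoint cylinders, so Kraft's inequality bounds the packing
sum. -/
theorem packingMeasure_range_ne_top (h : IsCantorCoding N s π c C) {d : ℝ≥0}
    (hd : limsup (scaleExponent N s) atTop < d) :
    packingMeasure (fun x => x ^ (d : ℝ)) (range π) ≠ ∞ := by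
  obtain ⟨n₀, hn₀⟩ := eventually_atTop.1
    ((eventually_lt_of_limsup_lt hd).and h.eventually_lt_one)
  have hN0 : (0 : ℝ) < N := by exact_mod_cast two_pos.trans_le h.two_le
  have hC := h.C_pos
  set K : ℝ≥0∞ := ENNReal.ofReal ((2 * C) ^ (d : ℝ) * N)
  -- One scale suffices; radii at most `C * s n₀` force every level to be at least `n₀`, where the
  -- exponent is below `d`. The factor `N` in `K` pays for the step from `n` to `n + 1`.
  suffices hK : packingDelta (fun x => x ^ (d : ℝ)) (C * s n₀) (range π) ≤ K from
    (((packingMeasure_le_packingDelta _ (mul_pos hC (h.pos n₀)) _).trans hK).trans_lt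
      ENNReal.ofReal_lt_top).ne
  refine iSup₂_le fun V hV => ?_
  choose w hw using fun q : V => (hV.1 q q.2).1
  choose n hn using fun q : V => h.exists_level (hV.1 q q.2).2.1 (hV.1 q q.2).2.2
  have hsub : ∀ q : V, π '' PiNat.cylinder (w q) (n q + 1) ⊆ Metric.ball q.1.1 q.1.2 := by
    rintro q _ ⟨w', hw', rfl⟩
    rw [Metric.mem_ball, ← hw q, dist_comm]
    exact (h.dist_le _ _ _ hw').trans_lt (hn q).2.1
  have hkraft := tsum_pow_inv_le_one_of_disjoint_cylinders (two_pos.trans_le h.two_le) w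
    (fun q => n q + 1) (by
      intro q q' hne
      have h1 := hV.2 q.2 q'.2 (fun heq => hne (Subtype.ext heq))
      refine Set.disjoint_left.2 fun v hv hv' => ?_
      exact Set.disjoint_left.1 h1 (hsub q (mem_image_of_mem _ hv))
        (hsub q' (mem_image_of_mem _ hv')))
  have hterm : ∀ q : V, Metric.ediam (Metric.ball q.1.1 q.1.2) ^ (d : ℝ)
      ≤ K * ((N : ℝ≥0∞)⁻¹) ^ (n q + 1) := by
    intro q
    have hs := h.pos (n q)
    have h1 := pow_mul_rpow_le_one_of_scaleExponent_lt h.two_le hs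
      (hn₀ _ (hn q).1).2 (hn₀ _ (hn q).1).1
    have hNinv : (N : ℝ≥0∞)⁻¹ = ENNReal.ofReal (N : ℝ)⁻¹ := by
      rw [ENNReal.ofReal_inv_of_pos hN0]; simp
    calc Metric.ediam (Metric.ball q.1.1 q.1.2) ^ (d : ℝ)
        ≤ ENNReal.ofReal (2 * C * s (n q)) ^ (d : ℝ) := by
          refine ENNReal.rpow_le_rpow ((ediam_ball_le _ _).trans
            (ENNReal.ofReal_le_ofReal ?_)) d.coe_nonneg
          linarith [(hn q).2.2]
      _ = ENNReal.ofReal ((2 * C) ^ (d : ℝ) * s (n q) ^ (d : ℝ)) := by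
          rw [ENNReal.ofReal_rpow_of_nonneg (by positivity) d.coe_nonneg,
            Real.mul_rpow (by positivity) hs.le]
      _ ≤ ENNReal.ofReal ((2 * C) ^ (d : ℝ) * N * (N : ℝ)⁻¹ ^ (n q + 1)) := by
          refine ENNReal.ofReal_le_ofReal ?_
          rw [mul_assoc]
          refine mul_le_mul_of_nonneg_left ?_ (by positivity)
          rw [pow_succ, mul_left_comm, mul_inv_cancel₀ hN0.ne', mul_one, inv_pow,
            le_inv_comm₀ (by positivity) (by positivity), le_inv_comm₀ (by positivity)
            (by positivity), ← one_div, le_div_iff₀ (by positivity), mul_comm]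
          exact h1
      _ = K * ((N : ℝ≥0∞)⁻¹) ^ (n q + 1) := by
          rw [hNinv, ENNReal.ofReal_mul (by positivity), ENNReal.ofReal_pow (by positivity)]
  calc ∑' q : V, Metric.ediam (Metric.ball q.1.1 q.1.2) ^ (d : ℝ)
      ≤ ∑' q : V, K * ((N : ℝ≥0∞)⁻¹) ^ (n q + 1) := ENNReal.tsum_le_tsum hterm
    _ ≤ K := by
        rw [ENNReal.tsum_mul_left]
        exact mul_le_of_le_one_right' hkraft

theorem packingDim_range_le (h : IsCantorCoding N s π c C) :
    packingDim (range π) ≤ limsup (scaleExponent N s) atTop := by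
  refine iSup₂_le fun d hd => ?_
  by_contra! hlt
  exact h.packingMeasure_range_ne_top hlt hd

/-- Baire category on the code space: the closed preimages cover it, so one has interior and
contains a cylinder. -/
theorem exists_cylinder_subset_closure (h : IsCantorCoding N s π c C) {U : ℕ → Set X}
    (hU : range π ⊆ ⋃ i, U i) :
    ∃ i w m, PiNat.cylinder w m ⊆ π ⁻¹' closure (U i) := by
  have := h.nonempty
  obtain ⟨i, x, hx⟩ := nonempty_interior_of_iUnion_of_closed
    (f := fun i => π ⁻¹' closure (U i)) (fun i => isClosed_closure.preimage h.continuous) (by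
      refine eq_univ_of_forall fun w => ?_
      obtain ⟨i, hi⟩ := mem_iUnion.1 (hU (mem_range_self w))
      exact mem_iUnion.2 ⟨i, subset_closure hi⟩)
  obtain ⟨_, ⟨w, m, rfl⟩, -, hsub⟩ :=
    (PiNat.isTopologicalBasis_cylinders fun _ : ℕ => Fin N).exists_subset_of_mem_open hx
      isOpen_interior
  exact ⟨i, w, m, hsub.trans interior_subset⟩

end MetricSpace

variable {E : Type*} [NormedAddCommGroup E] [NormedSpace ℝ E] [Nontrivial E] {N : ℕ}
  {s : ℕ → ℝ} {π : (ℕ → Fin N) → E} {c C : ℝ}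

/-- The `N ^ k` extensions of the cylinder to length `m + k` give separated points of `closure U`;
nudged into `U`, they are centres of disjoint balls. -/
theorem le_packingDelta_of_cylinder_subset (h : IsCantorCoding N s π c C) {U : Set E}
    {w : ℕ → Fin N} {m : ℕ} (hU : PiNat.cylinder w m ⊆ π ⁻¹' closure U) (k : ℕ) {δ : ℝ}
    (hδ : c * s (m + k) / 4 ≤ δ) (d : ℝ≥0) :
    ENNReal.ofReal ((N : ℝ) ^ k * (c / 2) ^ (d : ℝ) * s (m + k) ^ (d : ℝ))
      ≤ packingDelta (fun x => x ^ (d : ℝ)) δ U := by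
  -- The coded points are at least `4 * r` apart; moving each by less than `r` leaves distance `2 *
  -- r`.
  set r := c * s (m + k) / 4 with hr
  have hc := h.c_pos
  have hs := h.pos (m + k)
  have hr0 : 0 < r := by positivity
  set W : (Fin k → Fin N) → ℕ → Fin N := fun v j =>
    if hj : m ≤ j ∧ j - m < k then v ⟨j - m, hj.2⟩ else w j
  have hW : ∀ v, W v ∈ PiNat.cylinder w m := fun v j hj => by
    simp only [W]
    rw [dif_neg]
    omega
  have hWv : ∀ v (i : Fin k), W v (m + i) = v i := fun v i => by simp [W]
  choose y hyU hy using fun v => Metric.mem_closure_iff.1 (hU (hW v)) r hr0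
  have hdist : ∀ v v', v ≠ v' → r + r ≤ dist (y v) (y v') := by
    intro v v' hne
    obtain ⟨i, hi⟩ := Function.ne_iff.1 hne
    have h1 := h.le_dist (m + i) (W v) (W v') (by rwa [hWv, hWv])
    have h2 : s (m + k) ≤ s (m + i) := h.anti (by omega)
    have h3 := dist_triangle4 (π (W v)) (y v) (y v') (π (W v'))
    have h4 := hy v
    have h5 := hy v'
    rw [dist_comm] at h5
    have h6 := mul_le_mul_of_nonneg_left h2 hc.le
    linarith
  have hinj : Function.Injective fun v => (y v, r) := by
    intro v v' hv
    by_contra hne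
    have h1 := hdist v v' hne
    have h2 : y v = y v' := congrArg Prod.fst hv
    rw [h2, dist_self] at h1
    linarith
  have hpack : IsPacking δ U (range fun v => (y v, r)) := by
    refine ⟨?_, ?_⟩
    · rintro _ ⟨v, rfl⟩
      exact ⟨hyU v, hr0, hδ⟩
    · rintro _ ⟨v, rfl⟩ _ ⟨v', rfl⟩ hne
      exact Metric.ball_disjoint_ball (hdist v v' fun heq => hne (by rw [heq]))
  refine le_trans ?_ (le_iSup₂_of_le _ hpack le_rfl)
  rw [tsum_range (g := fun v => (y v, r))
    (fun q : E × ℝ => Metric.ediam (Metric.ball q.1 q.2) ^ (d : ℝ)) hinj, tsum_fintype]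
  calc ENNReal.ofReal ((N : ℝ) ^ k * (c / 2) ^ (d : ℝ) * s (m + k) ^ (d : ℝ))
      = ∑ _v : Fin k → Fin N, ENNReal.ofReal (2 * r) ^ (d : ℝ) := by
        have hN : (N : ℝ≥0∞) = ENNReal.ofReal N := by simp
        simp only [Finset.sum_const, Finset.card_univ, Fintype.card_fun, Fintype.card_fin,
          nsmul_eq_mul, Nat.cast_pow]
        rw [ENNReal.ofReal_rpow_of_nonneg (by positivity) d.coe_nonneg, hN,
          ← ENNReal.ofReal_pow (by positivity), ← ENNReal.ofReal_mul (by positivity), mul_assoc,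
          ← Real.mul_rpow (by positivity) hs.le]
        congr 3
        rw [hr]
        ring
    _ ≤ _ := Finset.sum_le_sum fun v _ =>
        ENNReal.rpow_le_rpow (ofReal_le_ediam_ball _ hr0.le) d.coe_nonneg

/-- Pick `d'` between `d` and the limsup. At infinitely many levels the `d'`-sum is at least 1, so
the `d`-sum is at least `s n ^ (d - d')`, which is unbounded; passing to a cylinder costs only the
fixed factor `N ^ m`. -/
theorem packingPremeasure_eq_top (h : IsCantorCoding N s π c C) {U : Set E}
    {w : ℕ → Fin N} {m : ℕ} (hU : PiNat.cylinder w m ⊆ π ⁻¹' closure U) {d : ℝ≥0}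
    (hd : d < limsup (scaleExponent N s) atTop) :
    packingPremeasure (fun x => x ^ (d : ℝ)) U = ∞ := by
  have hN0 : (0 : ℝ) < N := by exact_mod_cast two_pos.trans_le h.two_le
  have hc := h.c_pos
  obtain ⟨d', hdd', hd'⟩ := ENNReal.lt_iff_exists_nnreal_btwn.1 hd
  have hdd : (d : ℝ) < d' := by exact_mod_cast hdd'
  simp only [packingPremeasure, iInf_eq_top]
  intro δ hδ
  refine ENNReal.eq_top_of_forall_nnreal_le fun K => ?_
  have hgrow : Tendsto (fun n => s n ^ ((d : ℝ) - d')) atTop atTop :=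
    (tendsto_rpow_neg_nhdsGT_zero (by linarith)).comp
      (tendsto_nhdsWithin_iff.2 ⟨h.tendsto, Eventually.of_forall h.pos⟩)
  have hsmall : Tendsto (fun n => c * s n / 4) atTop (𝓝 0) := by
    simpa using (h.tendsto.const_mul c).div_const 4
  obtain ⟨n, hn, hn1, hnm, hnK, hnδ⟩ := ((frequently_lt_of_lt_limsup (by isBoundedDefault)
    hd').and_eventually (h.eventually_lt_one.and ((eventually_ge_atTop m).and
      ((hgrow.eventually_ge_atTop (K * (N : ℝ) ^ m / (c / 2) ^ (d : ℝ))).and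
        (hsmall.eventually_le_const hδ))))).exists
  obtain ⟨k, rfl⟩ := Nat.exists_eq_add_of_le hnm
  refine le_trans ?_ (h.le_packingDelta_of_cylinder_subset hU k hnδ d)
  rw [← ENNReal.ofReal_coe_nnreal]
  refine ENNReal.ofReal_le_ofReal ?_
  have hs := h.pos (m + k)
  have h1 := one_le_pow_mul_rpow_of_lt_scaleExponent h.two_le hs hn1 hn
  have h2 : s (m + k) ^ ((d : ℝ) - d') ≤ (N : ℝ) ^ (m + k) * s (m + k) ^ (d : ℝ) := by
    rw [Real.rpow_sub hs, div_le_iff₀ (by positivity)]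
    have h3 : 0 < s (m + k) ^ (d : ℝ) := by positivity
    nlinarith
  have h4 := hnK.trans h2
  rw [div_le_iff₀ (by positivity), pow_add] at h4
  refine le_of_mul_le_mul_right (h4.trans_eq ?_) (by positivity : (0 : ℝ) < (N : ℝ) ^ m)
  ring

theorem le_packingDim_range (h : IsCantorCoding N s π c C) :
    limsup (scaleExponent N s) atTop ≤ packingDim (range π) := by
  refine ENNReal.le_of_forall_nnreal_lt fun d hd => ?_
  refine le_iSup₂_of_le d ?_ le_rfl
  simp only [packingMeasure, iInf_eq_top]
  intro U hU
  obtain ⟨i, w, m, hi⟩ := h.exists_cylinder_subset_closure hU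
  exact ENNReal.tsum_eq_top_of_eq_top ⟨i, h.packingPremeasure_eq_top hi hd⟩

theorem packingDim_range (h : IsCantorCoding N s π c C) :
    packingDim (range π) = limsup (scaleExponent N s) atTop :=
  h.packingDim_range_le.antisymm h.le_packingDim_range

end IsCantorCoding

/-! ### Sum sets with separated digits -/

/-- Digit sets of `N` points containing `0`, with distances of distinct digits in `[τ, κ]`, and
scaling factors decaying rapidly relative to `κ` and `τ`. -/
structure HasSeparatedDigits {E : Type*} [NormedAddCommGroup E] (N : ℕ) (κ τ M : ℝ) (s : ℕ → ℝ)
    (D : ℕ → Finset E) : Prop where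
  two_le : 2 ≤ N
  pos : ∀ n, 0 < s n
  summable : Summable s
  card_eq : ∀ n, (D n).card = N
  zero_mem : ∀ n, (0 : E) ∈ D n
  tau_pos : 0 < τ
  lt_one : M < 1
  norm_le : ∀ n, ∀ x ∈ D n, ∀ y ∈ D n, ‖x - y‖ ≤ κ
  le_norm : ∀ n, ∀ x ∈ D n, ∀ y ∈ D n, x ≠ y → τ ≤ ‖x - y‖
  decay : ∀ n, κ * tailSum s n ≤ M * (τ * s n)

theorem tailSum_comp_le {s : ℕ → ℝ} (hpos : ∀ n, 0 < s n) (hs : Summable s) {φ : ℕ → ℕ}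
    (hφ : StrictMono φ) (n : ℕ) : tailSum (s ∘ φ) n ≤ tailSum s (φ n) := by
  have hlt : ∀ i, φ n + 1 ≤ φ (n + 1 + i) := fun i => hφ (by omega)
  have hinj : Function.Injective fun i => φ (n + 1 + i) - (φ n + 1) := by
    intro i j hij
    have h1 := hlt i
    have h2 := hlt j
    have h3 : φ (n + 1 + i) = φ (n + 1 + j) := by simp only at hij; omega
    have := hφ.injective h3
    omega
  have hsum : Summable fun i => s (φ n + 1 + i) := by
    simpa only [add_comm] using (summable_nat_add_iff (φ n + 1)).2 hs
  have h := tsum_comp_le_tsum_of_inj hsum (fun i => (hpos _).le) hinj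
  refine le_trans (le_of_eq ?_) h
  refine tsum_congr fun i => ?_
  simp only [Function.comp_apply]
  rw [Nat.add_sub_cancel' (hlt i)]

namespace HasSeparatedDigits

variable {E : Type*} [NormedAddCommGroup E] {N : ℕ} {κ τ M : ℝ} {s : ℕ → ℝ} {D : ℕ → Finset E}

theorem exists_ne (h : HasSeparatedDigits N κ τ M s D) (n : ℕ) :
    ∃ x ∈ D n, ∃ y ∈ D n, x ≠ y :=
  Finset.one_lt_card.1 (by rw [h.card_eq]; exact h.two_le)

theorem tau_le_kappa (h : HasSeparatedDigits N κ τ M s D) : τ ≤ κ := by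
  obtain ⟨x, hx, y, hy, hxy⟩ := h.exists_ne 0
  exact (h.le_norm 0 x hx y hy hxy).trans (h.norm_le 0 x hx y hy)

theorem kappa_pos (h : HasSeparatedDigits N κ τ M s D) : 0 < κ :=
  h.tau_pos.trans_le h.tau_le_kappa

theorem summable_tail (h : HasSeparatedDigits N κ τ M s D) (n : ℕ) :
    Summable fun i => s (n + 1 + i) := by
  simpa only [add_comm] using (summable_nat_add_iff (n + 1)).2 h.summable

theorem succ_le_tailSum (h : HasSeparatedDigits N κ τ M s D) (n : ℕ) :
    s (n + 1) ≤ tailSum s n :=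
  (h.summable_tail n).le_tsum 0 fun _ _ => (h.pos _).le

theorem ratio_pos (h : HasSeparatedDigits N κ τ M s D) : 0 < M := by
  have h1 := h.decay 0
  have h2 : 0 < κ * tailSum s 0 := mul_pos h.kappa_pos ((h.pos 1).trans_le (h.succ_le_tailSum 0))
  exact pos_of_mul_pos_left (h2.trans_le h1) (mul_pos h.tau_pos (h.pos 0)).le

theorem succ_le_mul (h : HasSeparatedDigits N κ τ M s D) (n : ℕ) : s (n + 1) ≤ M * s n := by
  have h1 := mul_le_mul_of_nonneg_left (h.succ_le_tailSum n) h.kappa_pos.le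
  have h2 : M * (τ * s n) ≤ M * (κ * s n) := mul_le_mul_of_nonneg_left
    (mul_le_mul_of_nonneg_right h.tau_le_kappa (h.pos n).le) h.ratio_pos.le
  refine le_of_mul_le_mul_left ?_ h.kappa_pos
  linarith [h.decay n]

theorem antitone (h : HasSeparatedDigits N κ τ M s D) : Antitone s :=
  antitone_nat_of_succ_le fun n => (h.succ_le_mul n).trans
    (mul_le_of_le_one_left (h.pos n).le h.lt_one.le)

theorem le_pow_mul (h : HasSeparatedDigits N κ τ M s D) (n : ℕ) : s n ≤ M ^ n * s 0 := by
  induction n with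
  | zero => simp
  | succ n ih =>
    calc s (n + 1) ≤ M * s n := h.succ_le_mul n
      _ ≤ M * (M ^ n * s 0) := mul_le_mul_of_nonneg_left ih h.ratio_pos.le
      _ = M ^ (n + 1) * s 0 := by ring

/-- Since `κ ≥ τ`, decay forces `s (n + 1) ≤ M * s n`; geometric decay keeps the exponents bounded.
-/
theorem limsup_scaleExponent_ne_top (h : HasSeparatedDigits N κ τ M s D) :
    limsup (scaleExponent N s) atTop ≠ ∞ := by
  have hN0 : (0 : ℝ) < N := by exact_mod_cast two_pos.trans_le h.two_le
  have hM := h.ratio_pos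
  have hs0 := h.pos 0
  -- With `N * M ^ d ≤ 1 / 2`, the level-`n` `d`-sum tends to 0, so the exponent is eventually at
  -- most `d`.
  obtain ⟨d, hd⟩ := exists_pow_lt_of_lt_one (by positivity : 0 < (2 * (N : ℝ))⁻¹) h.lt_one
  have hgeom : Tendsto (fun n => (1 / 2 : ℝ) ^ n * s 0 ^ d) atTop (𝓝 0) := by
    simpa using (tendsto_pow_atTop_nhds_zero_of_lt_one (by norm_num : (0 : ℝ) ≤ 1 / 2)
      (by norm_num)).mul_const (s 0 ^ d)
  have hev : ∀ᶠ n in atTop, scaleExponent N s n ≤ (d : ℝ≥0) := by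
    filter_upwards [hgeom.eventually_lt_const one_pos,
      h.summable.tendsto_atTop_zero.eventually_lt_const one_pos] with n hn hn1
    by_contra! hlt
    have h1 := one_le_pow_mul_rpow_of_lt_scaleExponent h.two_le (h.pos n) hn1 hlt
    have h2 : (N : ℝ) ^ n * s n ^ ((d : ℝ≥0) : ℝ) ≤ (1 / 2 : ℝ) ^ n * s 0 ^ d := by
      have h3 : N * M ^ d ≤ 1 / 2 := by
        have := mul_le_mul_of_nonneg_left hd.le hN0.le
        refine this.trans_eq ?_
        field_simp
      calc (N : ℝ) ^ n * s n ^ ((d : ℝ≥0) : ℝ) = (N : ℝ) ^ n * s n ^ d := by simp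
        _ ≤ (N : ℝ) ^ n * (M ^ n * s 0) ^ d := by
            gcongr
            · exact (h.pos n).le
            · exact h.le_pow_mul n
        _ = (N * M ^ d) ^ n * s 0 ^ d := by ring
        _ ≤ _ := by gcongr
    linarith
  exact ((limsup_le_of_le (by isBoundedDefault) hev).trans_lt ENNReal.coe_lt_top).ne

/-- Deleting terms only shrinks tails, and `κ`, `τ` are uniform bounds, so `ψ` can be arbitrary and
independent of `φ`. -/
theorem comp (h : HasSeparatedDigits N κ τ M s D) {φ : ℕ → ℕ} (hφ : StrictMono φ) (ψ : ℕ → ℕ) :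
    HasSeparatedDigits N κ τ M (s ∘ φ) (D ∘ ψ) where
  two_le := h.two_le
  pos _ := h.pos _
  summable := h.summable.comp_injective hφ.injective
  card_eq _ := h.card_eq _
  zero_mem _ := h.zero_mem _
  tau_pos := h.tau_pos
  lt_one := h.lt_one
  norm_le _ := h.norm_le _
  le_norm _ := h.le_norm _
  decay n := (mul_le_mul_of_nonneg_left (tailSum_comp_le h.pos h.summable hφ n)
    h.kappa_pos.le).trans (h.decay _)

variable [NormedSpace ℝ E]

theorem norm_smul_sub_le (h : HasSeparatedDigits N κ τ M s D) {a b : ℕ → E}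
    (ha : ∀ i, a i ∈ D i) (hb : ∀ i, b i ∈ D i) (i : ℕ) : ‖s i • (a i - b i)‖ ≤ κ * s i := by
  rw [norm_smul, Real.norm_of_nonneg (h.pos i).le, mul_comm]
  exact mul_le_mul_of_nonneg_right (h.norm_le i _ (ha i) _ (hb i)) (h.pos i).le

theorem norm_tsum_add_le (h : HasSeparatedDigits N κ τ M s D) {a b : ℕ → E}
    (ha : ∀ i, a i ∈ D i) (hb : ∀ i, b i ∈ D i) (n : ℕ) :
    ‖∑' i, s (i + (n + 1)) • (a (i + (n + 1)) - b (i + (n + 1)))‖ ≤ M * (τ * s n) := by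
  refine le_trans ?_ (h.decay n)
  refine tsum_of_norm_bounded (g := fun i => κ * s (n + 1 + i))
    ((h.summable_tail n).hasSum.mul_left κ) fun i => ?_
  rw [add_comm i]
  exact h.norm_smul_sub_le ha hb _

variable [CompleteSpace E]

theorem summable_smul_sub (h : HasSeparatedDigits N κ τ M s D) {a b : ℕ → E}
    (ha : ∀ i, a i ∈ D i) (hb : ∀ i, b i ∈ D i) : Summable fun i => s i • (a i - b i) :=
  Summable.of_norm_bounded (h.summable.mul_left κ) (h.norm_smul_sub_le ha hb)

theorem summable_smul (h : HasSeparatedDigits N κ τ M s D) {a : ℕ → E}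
    (ha : ∀ i, a i ∈ D i) : Summable fun i => s i • a i := by
  simpa using h.summable_smul_sub ha h.zero_mem

theorem tsum_sub_tsum_eq (h : HasSeparatedDigits N κ τ M s D) {a b : ℕ → E}
    (ha : ∀ i, a i ∈ D i) (hb : ∀ i, b i ∈ D i) {n : ℕ} (hab : ∀ i < n, a i = b i) :
    ∑' i, s i • a i - ∑' i, s i • b i = s n • (a n - b n) +
      ∑' i, s (i + (n + 1)) • (a (i + (n + 1)) - b (i + (n + 1))) := by
  rw [← (h.summable_smul ha).tsum_sub (h.summable_smul hb)]
  simp only [← smul_sub]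
  rw [← (h.summable_smul_sub ha hb).sum_add_tsum_nat_add (n + 1), Finset.sum_range_succ,
    Finset.sum_eq_zero, zero_add]
  intro i hi
  rw [hab i (Finset.mem_range.1 hi), sub_self, smul_zero]

theorem dist_tsum_le (h : HasSeparatedDigits N κ τ M s D) {a b : ℕ → E}
    (ha : ∀ i, a i ∈ D i) (hb : ∀ i, b i ∈ D i) {n : ℕ} (hab : ∀ i < n, a i = b i) :
    dist (∑' i, s i • a i) (∑' i, s i • b i) ≤ (κ + τ) * s n := by
  rw [dist_eq_norm, h.tsum_sub_tsum_eq ha hb hab]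
  have h1 := h.norm_tsum_add_le ha hb n
  have h2 := h.norm_smul_sub_le ha hb n
  have h3 : M * (τ * s n) ≤ τ * s n :=
    mul_le_of_le_one_left (mul_pos h.tau_pos (h.pos n)).le h.lt_one.le
  refine (norm_add_le _ _).trans ?_
  linarith

/-- The first differing term has norm at least `τ * s n`, while the tail after it contributes at
most `M * τ * s n`. -/
theorem le_dist_tsum (h : HasSeparatedDigits N κ τ M s D) {a b : ℕ → E}
    (ha : ∀ i, a i ∈ D i) (hb : ∀ i, b i ∈ D i) {n : ℕ} (hab : ∀ i < n, a i = b i)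
    (hne : a n ≠ b n) :
    (1 - M) * τ * s n ≤ dist (∑' i, s i • a i) (∑' i, s i • b i) := by
  rw [dist_eq_norm, h.tsum_sub_tsum_eq ha hb hab]
  have h1 := h.norm_tsum_add_le ha hb n
  have h2 : τ * s n ≤ ‖s n • (a n - b n)‖ := by
    rw [norm_smul, Real.norm_of_nonneg (h.pos n).le, mul_comm]
    exact mul_le_mul_of_nonneg_left (h.le_norm n _ (ha n) _ (hb n) hne) (h.pos n).le
  have h3 := norm_sub_le_norm_add (s n • (a n - b n))
    (∑' i, s (i + (n + 1)) • (a (i + (n + 1)) - b (i + (n + 1))))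
  linarith

theorem isCantorCoding (h : HasSeparatedDigits N κ τ M s D) (e : ∀ n, Fin N ≃ D n) :
    IsCantorCoding N s (fun w => ∑' i, s i • (e i (w i) : E)) ((1 - M) * τ) (κ + τ) where
  two_le := h.two_le
  pos := h.pos
  anti := h.antitone
  tendsto := h.summable.tendsto_atTop_zero
  c_pos := mul_pos (sub_pos.2 h.lt_one) h.tau_pos
  C_pos := add_pos h.kappa_pos h.tau_pos
  dist_le n w w' hw := h.dist_tsum_le (fun i => (e i (w i)).2) (fun i => (e i (w' i)).2)
    fun i hi => by rw [hw i hi]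
  le_dist n w w' hne := by
    have hww : w ≠ w' := fun heq => hne (heq ▸ rfl)
    have hle : PiNat.firstDiff w w' ≤ n := by
      by_contra! hlt
      exact hne (PiNat.apply_eq_of_lt_firstDiff hlt)
    refine le_trans (mul_le_mul_of_nonneg_left (h.antitone hle)
      (mul_pos (sub_pos.2 h.lt_one) h.tau_pos).le)
      (h.le_dist_tsum (fun i => (e i (w i)).2) (fun i => (e i (w' i)).2)
        (fun i hi => by rw [PiNat.apply_eq_of_lt_firstDiff hi]) fun heq => ?_)
    exact PiNat.apply_firstDiff_ne hww ((e _).injective (Subtype.ext heq))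

end HasSeparatedDigits

/-! ### Dimensions of sum sets -/

section SumSet

variable {p N : ℕ} {κ τ M : ℝ} {s : ℕ → ℝ} {D : ℕ → Finset (EuclideanSpace ℝ (Fin p))}

theorem HasSeparatedDigits.sumSet_eq_range (h : HasSeparatedDigits N κ τ M s D)
    (e : ∀ n, Fin N ≃ D n) :
    sumSet s D = range fun w : ℕ → Fin N =>
      ∑' i, s i • (e i (w i) : EuclideanSpace ℝ (Fin p)) := by
  ext x
  constructor
  · rintro ⟨b, hb, hx⟩
    exact ⟨fun i => (e i).symm ⟨b i, hb i⟩, by simpa using hx.tsum_eq⟩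
  · rintro ⟨w, rfl⟩
    exact ⟨fun i => e i (w i), fun i => (e i (w i)).2,
      (h.summable_smul fun i => (e i (w i)).2).hasSum⟩

theorem HasSeparatedDigits.dimH_sumSet (h : HasSeparatedDigits N κ τ M s D) :
    dimH (sumSet s D) = liminf (scaleExponent N s) atTop := by
  set e : ∀ n, Fin N ≃ D n := fun n => ((D n).equivFinOfCardEq (h.card_eq n)).symm
  rw [h.sumSet_eq_range e]
  exact (h.isCantorCoding e).dimH_range

theorem HasSeparatedDigits.packingDim_sumSet (h : HasSeparatedDigits N κ τ M s D) :
    packingDim (sumSet s D) = limsup (scaleExponent N s) atTop := by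
  set e : ∀ n, Fin N ≃ D n := fun n => ((D n).equivFinOfCardEq (h.card_eq n)).symm
  obtain ⟨x, -, y, -, hxy⟩ := h.exists_ne 0
  have : Nontrivial (EuclideanSpace ℝ (Fin p)) := ⟨x, y, hxy⟩
  rw [h.sumSet_eq_range e]
  exact (h.isCantorCoding e).packingDim_range

theorem digitDists_finite (F : Finset (EuclideanSpace ℝ (Fin p))) : (digitDists F).Finite := by
  refine ((F ×ˢ F).finite_toSet.image fun q => ‖q.1 - q.2‖).subset ?_
  rintro r ⟨x, hx, y, hy, -, rfl⟩
  exact ⟨(x, y), by simp [hx, hy], rfl⟩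

theorem tauDigit_nonneg (F : Finset (EuclideanSpace ℝ (Fin p))) : 0 ≤ tauDigit F :=
  Real.sInf_nonneg (by rintro r ⟨x, -, y, -, -, rfl⟩; exact norm_nonneg _)

theorem IsSumSetData.exists_hasSeparatedDigits (h : IsSumSetData N s D) :
    ∃ M, HasSeparatedDigits N (kappa D) (tau D) M s D := by
  obtain ⟨M, hM, hdecay⟩ := h.decay
  have hlower : ∀ n, ∀ x ∈ D n, ∀ y ∈ D n, x ≠ y → tau D ≤ ‖x - y‖ := fun n x hx y hy hxy =>
    (ciInf_le ⟨0, by rintro _ ⟨k, rfl⟩; exact tauDigit_nonneg _⟩ n).trans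
      (csInf_le (digitDists_finite _).bddBelow ⟨x, hx, y, hy, hxy, rfl⟩)
  have hupper : ∀ n, ∀ x ∈ D n, ∀ y ∈ D n, x ≠ y → ‖x - y‖ ≤ kappa D := fun n x hx y hy hxy =>
    (le_csSup (digitDists_finite _).bddAbove ⟨x, hx, y, hy, hxy, rfl⟩).trans
      (le_ciSup h.kappa_finite n)
  have hkappa : 0 ≤ kappa D := by
    obtain ⟨x, hx, y, hy, hxy⟩ := Finset.one_lt_card.1
      (show 1 < (D 0).card by rw [h.card_eq]; exact h.two_le)
    exact (norm_nonneg _).trans (hupper 0 x hx y hy hxy)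
  refine ⟨M, h.two_le, h.pos, h.summable, h.card_eq, h.zero_mem, h.tau_pos, hM, ?_, hlower, ?_⟩
  · intro n x hx y hy
    rcases eq_or_ne x y with rfl | hxy
    · simpa using hkappa
    · exact hupper n x hx y hy hxy
  · intro n
    exact (div_le_iff₀ (mul_pos h.tau_pos (h.pos n))).1 (hdecay n)

end SumSet

/-! ### Index sets with prescribed densities -/

theorem exists_lacunary_seq {Q : ℕ → ℕ → Prop} (hQ : ∀ k m, ∃ n ≥ m, Q k n) :
    ∃ T : ℕ → ℕ, StrictMono T ∧ (∀ k, (k + 1) * T k ≤ T (k + 1)) ∧ ∀ k, Q k (T k) := by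
  choose f hf hfQ using hQ
  set T : ℕ → ℕ := fun k => Nat.rec (f 0 1) (fun k t => f (k + 1) ((k + 1) * t + 1)) k
  have hT : ∀ k, (k + 1) * T k + 1 ≤ T (k + 1) := fun k => hf _ _
  refine ⟨T, strictMono_nat_of_lt_succ fun k => ?_, fun k => by linarith [hT k], ?_⟩
  · have := hT k
    nlinarith [Nat.zero_le (k * T k)]
  · rintro (_ | k)
    · exact hfQ _ _
    · exact hfQ _ _

open Classical in
/-- A sequence with value `b` on the blocks `[T (2 * k), T (2 * k + 1))` and `a` elsewhere. -/
noncomputable def blockSeq (T : ℕ → ℕ) (a b : ℝ) (i : ℕ) : ℝ :=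
  if ∃ k, T (2 * k) ≤ i ∧ i < T (2 * k + 1) then b else a

theorem le_blockSeq {T : ℕ → ℕ} {a b : ℝ} (hab : a ≤ b) (i : ℕ) : a ≤ blockSeq T a b i := by
  unfold blockSeq
  split_ifs <;> simp [hab]

theorem blockSeq_le {T : ℕ → ℕ} {a b : ℝ} (hab : a ≤ b) (i : ℕ) : blockSeq T a b i ≤ b := by
  unfold blockSeq
  split_ifs <;> simp [hab]

theorem blockSeq_of_even {T : ℕ → ℕ} {a b : ℝ} {k i : ℕ} (h1 : T (2 * k) ≤ i)
    (h2 : i < T (2 * k + 1)) : blockSeq T a b i = b :=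
  if_pos ⟨k, h1, h2⟩

theorem blockSeq_of_odd {T : ℕ → ℕ} (hT : StrictMono T) {a b : ℝ} {k i : ℕ}
    (h1 : T (2 * k + 1) ≤ i) (h2 : i < T (2 * k + 2)) : blockSeq T a b i = a := by
  refine if_neg ?_
  rintro ⟨l, hl1, hl2⟩
  have h3 := hT.lt_iff_lt.1 (h1.trans_lt hl2)
  have h4 := hT.lt_iff_lt.1 (hl1.trans_lt h2)
  omega

theorem sum_range_mem_Icc {f : ℕ → ℝ} {a b : ℝ} (ha : ∀ i, a ≤ f i) (hb : ∀ i, f i ≤ b) (n : ℕ) :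
    ∑ i ∈ Finset.range n, f i ∈ Icc (n * a) (n * b) := by
  constructor
  · simpa using Finset.card_nsmul_le_sum (Finset.range n) f a fun i _ => ha i
  · simpa using Finset.sum_le_card_nsmul (Finset.range n) f b fun i _ => hb i

/-- The averages of a sequence in `[0, 1]` that is constant on a long block are close to its value
there. -/
theorem abs_average_sub_le {f : ℕ → ℝ} (h0 : ∀ i, 0 ≤ f i) (h1 : ∀ i, f i ≤ 1) {m n k : ℕ} {v : ℝ}
    (hv0 : 0 ≤ v) (hv1 : v ≤ 1) (hmn : m < n) (hk : (k + 1) * m ≤ n)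
    (hf : ∀ i, m ≤ i → i < n → f i = v) :
    |(∑ i ∈ Finset.range n, f i) / n - v| ≤ 1 / ((k : ℝ) + 1) := by
  have hn : (0 : ℝ) < n := by exact_mod_cast (Nat.zero_le m).trans_lt hmn
  have hsum : ∑ i ∈ Finset.range n, f i = ∑ i ∈ Finset.range m, f i + (n - m) * v := by
    rw [← Finset.sum_range_add_sum_Ico f hmn.le, Finset.sum_congr rfl fun i hi =>
      hf i (Finset.mem_Ico.1 hi).1 (Finset.mem_Ico.1 hi).2]
    simp [Nat.cast_sub hmn.le]
  have hm := sum_range_mem_Icc h0 h1 m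
  have hk' : ((k : ℝ) + 1) * m ≤ n := by exact_mod_cast hk
  have heq : (∑ i ∈ Finset.range n, f i) / n - v = (∑ i ∈ Finset.range m, f i - m * v) / n := by
    rw [hsum]
    field_simp
    ring
  have hmv : (m : ℝ) * v ≤ m := mul_le_of_le_one_right (Nat.cast_nonneg m) hv1
  have hmv0 : 0 ≤ (m : ℝ) * v := by positivity
  rw [heq, abs_div, abs_of_pos hn, div_le_div_iff₀ hn (by positivity)]
  have habs : |∑ i ∈ Finset.range m, f i - m * v| ≤ m :=
    abs_le.2 ⟨by linarith [hm.1], by linarith [hm.2]⟩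
  calc _ ≤ (m : ℝ) * (k + 1) := by gcongr
    _ ≤ _ := by linarith

/-- Each block starts within the first `1 / (r j + 1)` fraction of its end point, so its value
dominates the average. -/
theorem tendsto_average_of_blocks {f : ℕ → ℝ} (h0 : ∀ i, 0 ≤ f i) (h1 : ∀ i, f i ≤ 1) {T : ℕ → ℕ}
    (hT : StrictMono T) (hTk : ∀ k, (k + 1) * T k ≤ T (k + 1)) {r : ℕ → ℕ} (hr : StrictMono r)
    {v : ℝ} (hv0 : 0 ≤ v) (hv1 : v ≤ 1)
    (hf : ∀ j i, T (r j) ≤ i → i < T (r j + 1) → f i = v) :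
    Tendsto (fun j => (∑ i ∈ Finset.range (T (r j + 1)), f i) / (T (r j + 1) : ℝ)) atTop (𝓝 v) := by
  rw [tendsto_iff_dist_tendsto_zero]
  refine squeeze_zero (fun _ => dist_nonneg) (fun j => ?_)
    (tendsto_one_div_add_atTop_nhds_zero_nat.comp hr.tendsto_atTop)
  exact abs_average_sub_le h0 h1 hv0 hv1 (hT (Nat.lt_succ_self _)) (hTk _) (hf j)

/-- A set of natural numbers with prescribed local density `f`, given by its enumeration `φ` and its
counting function `u`. -/
theorem exists_enumeration_of_density {f : ℕ → ℝ} (h0 : ∀ i, 0 ≤ f i) (h1 : ∀ i, f i ≤ 1) :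
    ∃ φ u : ℕ → ℕ, StrictMono φ ∧ (∀ k, u (φ k) = k) ∧ (∀ n, n ≤ φ (u n)) ∧
      (∀ n k, k < u n → φ k < n) ∧ Tendsto u atTop atTop ∧
      Tendsto (fun n => (u n : ℝ) / n - (∑ i ∈ Finset.range n, f i) / n) atTop (𝓝 0) := by
  classical
  -- The harmonic term makes the sums diverge, so infinitely many indices are kept even if `f`
  -- vanishes; its Cesàro means tend to 0, so densities are unaffected.
  set e : ℕ → ℝ := fun i => 1 / ((i : ℝ) + 1)
  set g : ℕ → ℝ := fun n => ∑ i ∈ Finset.range n, max (f i) (e i) with hg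
  have he0 : ∀ i, 0 ≤ e i := fun i => by positivity
  have he1 : ∀ i, e i ≤ 1 := fun i => by
    refine div_le_one_of_le₀ ?_ (by positivity)
    linarith [(Nat.cast_nonneg i : (0 : ℝ) ≤ i)]
  have hg0 : ∀ n, 0 ≤ g n := fun n =>
    Finset.sum_nonneg fun i _ => (he0 i).trans (le_max_right _ _)
  have hgs : ∀ n, g (n + 1) = g n + max (f n) (e n) := fun n => Finset.sum_range_succ _ _
  set u : ℕ → ℕ := fun n => ⌊g n⌋₊ with hu
  have humono : ∀ n, u n ≤ u (n + 1) := fun n => Nat.floor_le_floor (by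
    rw [hgs]; linarith [(he0 n).trans (le_max_right (f n) (e n))])
  have hustep : ∀ n, u (n + 1) ≤ u n + 1 := fun n => by
    rw [hu]
    simp only
    rw [← Nat.floor_add_one (hg0 n)]
    exact Nat.floor_le_floor (by rw [hgs]; linarith [max_le (h1 n) (he1 n)])
  have hutop : Tendsto u atTop atTop := by
    refine tendsto_nat_floor_atTop.comp (tendsto_atTop_mono (fun n => ?_)
      Real.tendsto_sum_range_one_div_nat_succ_atTop)
    exact Finset.sum_le_sum fun i _ => le_max_right _ _
  -- Keep `n` when the rounded-down sum jumps; each jump is by exactly 1, so `u` counts the kept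
  -- indices.
  set P : ℕ → Prop := fun n => u n < u (n + 1)
  have hcount : ∀ n, Nat.count P n = u n := by
    intro n
    induction n with
    | zero => simp [hu, hg]
    | succ n ih =>
      rw [Nat.count_succ, ih]
      have h2 := humono n
      have h3 := hustep n
      split_ifs with h
      · have h4 : u n < u (n + 1) := h
        omega
      · have h4 : ¬ u n < u (n + 1) := h
        omega
  have hinf : (Set.ofPred P).Infinite := by
    refine Nat.frequently_atTop_iff_infinite.1 fun hev => ?_
    obtain ⟨n₀, hn₀⟩ := eventually_atTop.1 hev
    have hle : ∀ n ≥ n₀, u n ≤ u n₀ := fun n hn => by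
      induction n, hn using Nat.le_induction with
      | base => exact le_rfl
      | succ n hn ih => exact (not_lt.1 (hn₀ n hn)).trans ih
    obtain ⟨n, hn1, hn2⟩ := ((eventually_ge_atTop n₀).and
      (hutop.eventually_gt_atTop (u n₀))).exists
    exact absurd (hle n hn1) (not_le.2 hn2)
  refine ⟨Nat.nth P, u, Nat.nth_strictMono hinf, fun k => ?_, fun n => ?_, fun n k hk => ?_,
    hutop, ?_⟩
  · rw [← hcount, Nat.count_nth_of_infinite hinf]
  · rw [← hcount]
    exact Nat.le_nth_count hinf n
  · rw [← hcount] at hk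
    exact Nat.nth_lt_of_lt_count hk
  · have hlim : Tendsto (fun n : ℕ => (n : ℝ)⁻¹ + (n : ℝ)⁻¹ * ∑ i ∈ Finset.range n, e i) atTop
        (𝓝 0) := by
      have h := (tendsto_inv_atTop_nhds_zero_nat (𝕜 := ℝ)).add
        (tendsto_one_div_add_atTop_nhds_zero_nat (𝕜 := ℝ)).cesaro
      rwa [add_zero] at h
    refine squeeze_zero_norm (fun n => ?_) hlim
    have h2 : ∑ i ∈ Finset.range n, f i ≤ g n := Finset.sum_le_sum fun i _ => le_max_left _ _
    have h3 : g n ≤ ∑ i ∈ Finset.range n, f i + ∑ i ∈ Finset.range n, e i := by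
      rw [← Finset.sum_add_distrib]
      refine Finset.sum_le_sum fun i _ => max_le ?_ ?_
      · linarith [he0 i]
      · linarith [h0 i]
    have h4 : (u n : ℝ) ≤ g n := Nat.floor_le (hg0 n)
    have h5 : g n < u n + 1 := Nat.lt_floor_add_one _
    have h6 : 0 ≤ ∑ i ∈ Finset.range n, e i := Finset.sum_nonneg fun i _ => he0 i
    rw [← sub_div, div_eq_inv_mul, norm_mul, Real.norm_of_nonneg (by positivity), Real.norm_eq_abs]
    calc (n : ℝ)⁻¹ * |(u n : ℝ) - ∑ i ∈ Finset.range n, f i|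
        ≤ (n : ℝ)⁻¹ * (1 + ∑ i ∈ Finset.range n, e i) := by
          gcongr
          exact abs_le.2 ⟨by linarith, by linarith⟩
      _ = _ := by ring

theorem exists_enumeration_of_two_densities {a b : ℝ} (ha : 0 ≤ a) (hab : a ≤ b) (hb : b ≤ 1)
    {Q R : ℕ → ℕ → Prop} (hQ : ∀ k m, ∃ n ≥ m, Q k n) (hR : ∀ k m, ∃ n ≥ m, R k n) :
    ∃ φ u x y : ℕ → ℕ, StrictMono φ ∧ (∀ k, u (φ k) = k) ∧ (∀ n, n ≤ φ (u n)) ∧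
      (∀ n k, k < u n → φ k < n) ∧ Tendsto u atTop atTop ∧
      (∃ ε : ℕ → ℝ, Tendsto ε atTop (𝓝 0) ∧
        ∀ n : ℕ, 0 < n → a + ε n ≤ u n / n ∧ (u n : ℝ) / n ≤ b + ε n) ∧
      StrictMono x ∧ (∀ k, Q k (x k)) ∧
      Tendsto (fun k => (u (x k) : ℝ) / x k) atTop (𝓝 a) ∧
      StrictMono y ∧ (∀ k, R k (y k)) ∧
      Tendsto (fun k => (u (y k) : ℝ) / y k) atTop (𝓝 b) := by
  -- Blocks of value `b` end at odd-indexed `T`, where `R` is imposed; blocks of value `a` end at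
  -- positive even-indexed `T`, where `Q` is imposed. `T 0` is unconstrained.
  obtain ⟨T, hT, hTk, hTQ⟩ := exists_lacunary_seq
    (Q := fun k n => (∀ j, k = 2 * j + 2 → Q j n) ∧ (∀ j, k = 2 * j + 1 → R j n)) (by
      intro k m
      rcases Nat.even_or_odd' k with ⟨j, rfl | rfl⟩
      · obtain ⟨n, hn, hQn⟩ := hQ (j - 1) m
        exact ⟨n, hn, fun i hi => (show i = j - 1 by omega) ▸ hQn, fun i hi => by omega⟩
      · obtain ⟨n, hn, hRn⟩ := hR j m
        exact ⟨n, hn, fun i hi => by omega, fun i hi => (show i = j by omega) ▸ hRn⟩)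
  set f := blockSeq T a b
  have hfa : ∀ i, a ≤ f i := le_blockSeq hab
  have hfb : ∀ i, f i ≤ b := blockSeq_le hab
  have hf0 : ∀ i, 0 ≤ f i := fun i => ha.trans (hfa i)
  have hf1 : ∀ i, f i ≤ 1 := fun i => (hfb i).trans hb
  obtain ⟨φ, u, hφ, huφ, hφu, hlt, hutop, hlim⟩ := exists_enumeration_of_density hf0 hf1
  have hx : StrictMono fun j => T (2 * j + 2) := fun i j hij => hT (by omega)
  have hy : StrictMono fun j => T (2 * j + 1) := fun i j hij => hT (by omega)
  refine ⟨φ, u, fun j => T (2 * j + 2), fun j => T (2 * j + 1), hφ, huφ, hφu, hlt, hutop,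
    ⟨_, hlim, fun n hn => ?_⟩, hx, fun k => (hTQ _).1 k rfl, ?_, hy, fun k => (hTQ _).2 k rfl, ?_⟩
  · have hn' : (0 : ℝ) < n := by exact_mod_cast hn
    have h1 := sum_range_mem_Icc hfa hfb n
    have h2 : a ≤ (∑ i ∈ Finset.range n, f i) / n := by
      rw [le_div_iff₀ hn', mul_comm]; exact h1.1
    have h3 : (∑ i ∈ Finset.range n, f i) / n ≤ b := by
      rw [div_le_iff₀ hn', mul_comm]; exact h1.2
    constructor <;> linarith
  · have h1 := tendsto_average_of_blocks hf0 hf1 hT hTk (r := fun j => 2 * j + 1)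
      (fun i j hij => by simp only; omega) ha (hab.trans hb)
      fun j i hi1 hi2 => blockSeq_of_odd hT hi1 hi2
    simpa using (hlim.comp hx.tendsto_atTop).add h1
  · have h1 := tendsto_average_of_blocks hf0 hf1 hT hTk (r := fun j => 2 * j)
      (fun i j hij => by simp only; omega) (ha.trans hab) hb
      fun j i hi1 hi2 => blockSeq_of_even hi1 hi2
    simpa using (hlim.comp hy.tendsto_atTop).add h1

/-! ### Exponents along a subsequence -/

section Exponent

variable {N : ℕ} {s : ℕ → ℝ}

theorem scaleExponent_comp_eq_mul {φ : ℕ → ℕ} (hφ : StrictMono φ) (k : ℕ) :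
    scaleExponent N (s ∘ φ) k
      = ENNReal.ofReal ((k : ℝ) / φ k) * scaleExponent N s (φ k) := by
  rw [scaleExponent, scaleExponent, ← ENNReal.ofReal_mul (by positivity)]
  congr 1
  rcases Nat.eq_zero_or_pos (φ k) with h0 | h0
  · have : k = 0 := by have := hφ.id_le k; simp only [id] at this; omega
    subst this
    simp
  · have : (φ k : ℝ) ≠ 0 := by positivity
    simp only [Function.comp_apply]
    field_simp

theorem ofReal_div_mul_scaleExponent {m n : ℕ} (hn : 0 < n) :
    ENNReal.ofReal ((m : ℝ) / n) * scaleExponent N s n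
      = ENNReal.ofReal (m * Real.log N / (-Real.log (s n))) := by
  have : (n : ℝ) ≠ 0 := by positivity
  rw [scaleExponent, ← ENNReal.ofReal_mul (by positivity)]
  congr 1
  field_simp

theorem ofReal_div_neg_log_anti {x y c : ℝ} (hc : 0 ≤ c) (hx : 0 < x) (hxy : x ≤ y) (hy : y < 1) :
    ENNReal.ofReal (c / (-Real.log x)) ≤ ENNReal.ofReal (c / (-Real.log y)) := by
  have h1 : 0 < -Real.log y := neg_pos.2 (Real.log_neg (hx.trans_le hxy) hy)
  have h2 := Real.log_le_log hx hxy
  exact ENNReal.ofReal_le_ofReal (by gcongr)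

theorem tendsto_ofReal_div_neg_log (hpos : ∀ n, 0 < s n) (hs : Tendsto s atTop (𝓝 0)) (c : ℝ) :
    Tendsto (fun n => ENNReal.ofReal (c / (-Real.log (s n)))) atTop (𝓝 0) := by
  have h1 : Tendsto (fun n => -Real.log (s n)) atTop atTop :=
    tendsto_neg_atBot_atTop.comp (Real.tendsto_log_nhdsGT_zero.comp
      (tendsto_nhdsWithin_iff.2 ⟨hs, Eventually.of_forall hpos⟩))
  simpa using ENNReal.tendsto_ofReal (h1.const_div_atTop c)

theorem exists_le_liminf_add (h : liminf (scaleExponent N s) atTop ≠ ∞) (k m : ℕ) :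
    ∃ n ≥ m, scaleExponent N s n ≤ liminf (scaleExponent N s) atTop + ((k : ℝ≥0∞) + 1)⁻¹ := by
  have h1 : liminf (scaleExponent N s) atTop
      < liminf (scaleExponent N s) atTop + ((k : ℝ≥0∞) + 1)⁻¹ :=
    ENNReal.lt_add_right h (by simp)
  obtain ⟨n, hn1, hn2⟩ := ((frequently_lt_of_liminf_lt (by isBoundedDefault) h1).and_eventually
    (eventually_ge_atTop m)).exists
  exact ⟨n, hn2, hn1.le⟩

theorem exists_limsup_sub_le (h : limsup (scaleExponent N s) atTop ≠ ∞) (k m : ℕ) :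
    ∃ n ≥ m, limsup (scaleExponent N s) atTop - ((k : ℝ≥0∞) + 1)⁻¹ ≤ scaleExponent N s n := by
  rcases eq_or_ne (limsup (scaleExponent N s) atTop) 0 with h0 | h0
  · exact ⟨m, le_rfl, by simp [h0]⟩
  have h1 : limsup (scaleExponent N s) atTop - ((k : ℝ≥0∞) + 1)⁻¹
      < limsup (scaleExponent N s) atTop := ENNReal.sub_lt_self h h0 (by simp)
  obtain ⟨n, hn1, hn2⟩ := ((frequently_lt_of_lt_limsup (by isBoundedDefault) h1).and_eventually
    (eventually_ge_atTop m)).exists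
  exact ⟨n, hn2, hn1.le⟩

theorem tendsto_natCast_add_one_inv :
    Tendsto (fun k : ℕ => ((k : ℝ≥0∞) + 1)⁻¹) atTop (𝓝 0) := by
  have h := (tendsto_add_atTop_iff_nat 1).2 ENNReal.tendsto_inv_nat_nhds_zero
  simpa using h

theorem exists_strictMono_liminf_limsup_scaleExponent (hN : 2 ≤ N) (hpos : ∀ n, 0 < s n)
    (hanti : Antitone s) (hs : Tendsto s atTop (𝓝 0))
    (htop : limsup (scaleExponent N s) atTop ≠ ∞) {a b : ℝ} (ha : 0 ≤ a) (hab : a ≤ b)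
    (hb : b ≤ 1) :
    ∃ φ : ℕ → ℕ, StrictMono φ ∧
      liminf (scaleExponent N (s ∘ φ)) atTop
        = ENNReal.ofReal a * liminf (scaleExponent N s) atTop ∧
      limsup (scaleExponent N (s ∘ φ)) atTop
        = ENNReal.ofReal b * limsup (scaleExponent N s) atTop := by
  have htop' : liminf (scaleExponent N s) atTop ≠ ∞ :=
    ((liminf_le_limsup (by isBoundedDefault) (by isBoundedDefault)).trans_lt (lt_top_iff_ne_top.2 htop)).ne
  obtain ⟨φ, u, x, y, hφ, huφ, hφu, hlt, hutop, ⟨ε, hε, hbd⟩, hx, hxQ, hxa, hy, hyR, hyb⟩ :=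
    exists_enumeration_of_two_densities ha hab hb (exists_le_liminf_add htop')
      (exists_limsup_sub_le htop)
  have hlogN : 0 ≤ Real.log N := Real.log_nonneg (by exact_mod_cast one_le_two.trans hN)
  have hcomp : scaleExponent N (s ∘ φ)
      = (fun k : ℕ => ENNReal.ofReal ((k : ℝ) / φ k)) * fun k => scaleExponent N s (φ k) :=
    funext fun k => scaleExponent_comp_eq_mul hφ k
  have hs1 : ∀ᶠ n in atTop, s n < 1 := hs.eventually_lt_const one_pos
  have hφtop := hφ.tendsto_atTop
  have hdens : ∀ v : ℝ, Tendsto (fun k => ENNReal.ofReal (v + ε (φ k))) atTop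
      (𝓝 (ENNReal.ofReal v)) := fun v =>
    ENNReal.tendsto_ofReal (by simpa using (hε.comp hφtop).const_add v)
  have hφbd : ∀ᶠ k in atTop, a + ε (φ k) ≤ (k : ℝ) / φ k ∧ (k : ℝ) / φ k ≤ b + ε (φ k) := by
    filter_upwards [hφtop.eventually_gt_atTop 0] with k hk
    simpa only [huφ] using hbd (φ k) hk
  refine ⟨φ, hφ, le_antisymm ?_ ?_, le_antisymm ?_ ?_⟩
  -- Test at index `u (x j)`: the retained term there has `φ (u (x j)) ≥ x j`, so it is no larger
  -- than `s (x j)` and its exponent is at most density times old exponent.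
  · have hk : Tendsto (fun j => u (x j)) atTop atTop := hutop.comp hx.tendsto_atTop
    calc liminf (scaleExponent N (s ∘ φ)) atTop
        ≤ liminf (fun j => scaleExponent N (s ∘ φ) (u (x j))) atTop :=
          liminf_le_liminf_of_le hk
      _ ≤ liminf (fun j => ENNReal.ofReal ((u (x j) : ℝ) / x j) *
            (liminf (scaleExponent N s) atTop + ((j : ℝ≥0∞) + 1)⁻¹)) atTop := by
          refine liminf_le_liminf ?_
          filter_upwards [hx.tendsto_atTop.eventually hs1,
            hx.tendsto_atTop.eventually_gt_atTop 0] with j hj hj0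
          refine le_trans ?_ (mul_le_mul_right (hxQ j) _)
          rw [ofReal_div_mul_scaleExponent hj0]
          exact ofReal_div_neg_log_anti (by positivity) (hpos _) (hanti (hφu _)) hj
      _ = _ := by
          refine Tendsto.liminf_eq (ENNReal.Tendsto.mul (ENNReal.tendsto_ofReal hxa)
            (Or.inr htop') ?_ (Or.inr ENNReal.ofReal_ne_top))
          simpa using tendsto_natCast_add_one_inv.const_add (liminf (scaleExponent N s) atTop)
  · rw [hcomp]
    refine le_trans (mul_le_mul' ?_ ?_) ENNReal.le_liminf_mul
    · rw [← (hdens a).liminf_eq]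
      refine liminf_le_liminf ?_
      filter_upwards [hφbd] with k hk using ENNReal.ofReal_le_ofReal hk.1
    · exact liminf_le_liminf_of_le hφtop
  · have h1 : limsup (fun k : ℕ => ENNReal.ofReal ((k : ℝ) / φ k)) atTop ≤ ENNReal.ofReal b := by
      rw [← (hdens b).limsup_eq]
      refine limsup_le_limsup ?_
      filter_upwards [hφbd] with k hk using ENNReal.ofReal_le_ofReal hk.2
    have h2 : limsup (fun k => scaleExponent N s (φ k)) atTop
        ≤ limsup (scaleExponent N s) atTop := limsup_le_limsup_of_le hφtop
    rw [hcomp]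
    exact (ENNReal.limsup_mul_le' (Or.inr (h2.trans_lt (lt_top_iff_ne_top.2 htop)).ne)
      (Or.inl (h1.trans_lt ENNReal.ofReal_lt_top).ne)).trans (mul_le_mul' h1 h2)
  -- Here the reverse bound needs a retained index below `y j`. The last one is `φ (u (y j) - 1)`;
  -- losing one count costs `log N / (-log s)`, which tends to 0.
  · have huy : Tendsto (fun j => u (y j)) atTop atTop := hutop.comp hy.tendsto_atTop
    have hk : Tendsto (fun j => u (y j) - 1) atTop atTop := (tendsto_sub_atTop_nat 1).comp huy
    have hφk : Tendsto (fun j => φ (u (y j) - 1)) atTop atTop := hφtop.comp hk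
    have herr : Tendsto (fun j => ENNReal.ofReal
        (Real.log N / (-Real.log (s (φ (u (y j) - 1)))))) atTop (𝓝 0) :=
      (tendsto_ofReal_div_neg_log hpos hs (Real.log N)).comp hφk
    calc ENNReal.ofReal b * limsup (scaleExponent N s) atTop
        = limsup (fun j => ENNReal.ofReal ((u (y j) : ℝ) / y j) *
            (limsup (scaleExponent N s) atTop - ((j : ℝ≥0∞) + 1)⁻¹) - ENNReal.ofReal
            (Real.log N / (-Real.log (s (φ (u (y j) - 1)))))) atTop := by
          refine (Tendsto.limsup_eq ?_).symm
          have h1 : Tendsto (fun j : ℕ => limsup (scaleExponent N s) atTop - ((j : ℝ≥0∞) + 1)⁻¹)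
              atTop (𝓝 (limsup (scaleExponent N s) atTop)) := by
            simpa using ENNReal.Tendsto.sub tendsto_const_nhds tendsto_natCast_add_one_inv
              (Or.inl htop)
          have h2 := ENNReal.Tendsto.mul (ENNReal.tendsto_ofReal hyb) (Or.inr htop) h1
            (Or.inr ENNReal.ofReal_ne_top)
          simpa using ENNReal.Tendsto.sub h2 herr
            (Or.inl (ENNReal.mul_ne_top ENNReal.ofReal_ne_top htop))
      _ ≤ limsup (fun j => scaleExponent N (s ∘ φ) (u (y j) - 1)) atTop := by
          refine limsup_le_limsup ?_
          filter_upwards [hφk.eventually hs1, huy.eventually_gt_atTop 0,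
            hy.tendsto_atTop.eventually_gt_atTop 0] with j hj hj0 hjy
          rw [tsub_le_iff_right]
          refine (mul_le_mul_right (hyR j) _).trans ?_
          rw [ofReal_div_mul_scaleExponent hjy]
          have hlog : 0 < -Real.log (s (φ (u (y j) - 1))) := neg_pos.2 (Real.log_neg (hpos _) hj)
          refine (ofReal_div_neg_log_anti (by positivity) (hpos _)
            (hanti (hlt (y j) (u (y j) - 1) (by omega)).le) hj).trans_eq ?_
          rw [scaleExponent, ← ENNReal.ofReal_add (by simp only [Function.comp_apply]; positivity)
            (by positivity), Nat.cast_sub (by omega : 1 ≤ u (y j))]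
          congr 1
          simp only [Function.comp_apply]
          rw [← add_div]
          push_cast
          ring
      _ ≤ _ := limsup_le_limsup_of_le hk

end Exponent

/-! ### Conclusion -/

theorem theorem5 {p : ℕ} (N : ℕ) (s : ℕ → ℝ)
    (D : ℕ → Finset (EuclideanSpace ℝ (Fin p))) (hsD : IsSumSetData N s D)
    (A B : ℝ≥0∞) (hA : dimH (sumSet s D) = A) (hB : packingDim (sumSet s D) = B)
    (α β : ℝ≥0∞) (hα : α ≤ A) (hβ : β ≤ B) (hαβ : α / A ≤ β / B) :
    ∃ φ : ℕ → ℕ, StrictMono φ ∧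
      (dimH (sumSet (s ∘ φ) D) = α ∧ packingDim (sumSet (s ∘ φ) D) = β) ∧
      (dimH (sumSet (s ∘ φ) (D ∘ φ)) = α ∧ packingDim (sumSet (s ∘ φ) (D ∘ φ)) = β) := by
  obtain ⟨M, h⟩ := hsD.exists_hasSeparatedDigits
  rw [h.dimH_sumSet] at hA
  rw [h.packingDim_sumSet] at hB
  have htop := h.limsup_scaleExponent_ne_top
  have hAB : A ≤ B := by rw [← hA, ← hB]; exact liminf_le_limsup (by isBoundedDefault) (by isBoundedDefault)
  have hBtop : B ≠ ∞ := hB ▸ htop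
  have hAtop : A ≠ ∞ := (hAB.trans_lt (lt_top_iff_ne_top.2 hBtop)).ne
  -- This includes `y = 0`: then `x = 0`, and `0 / 0 = 0` agrees with the convention.
  have hmul : ∀ {x y : ℝ≥0∞}, x ≤ y → y ≠ ∞ → x / y * y = x := fun {x y} hxy hy =>
    ENNReal.div_mul_cancel' (fun h0 => le_antisymm (h0 ▸ hxy) bot_le) fun h0 => absurd h0 hy
  have hα1 : α / A ≤ 1 := ENNReal.div_le_of_le_mul (by rwa [one_mul])
  have hβ1 : β / B ≤ 1 := ENNReal.div_le_of_le_mul (by rwa [one_mul])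
  have hβtop : β / B ≠ ∞ := (hβ1.trans_lt ENNReal.one_lt_top).ne
  have hαtop : α / A ≠ ∞ := (hα1.trans_lt ENNReal.one_lt_top).ne
  obtain ⟨φ, hφ, hlow, hupp⟩ := exists_strictMono_liminf_limsup_scaleExponent h.two_le h.pos
    h.antitone h.summable.tendsto_atTop_zero htop ENNReal.toReal_nonneg
    (ENNReal.toReal_mono hβtop hαβ) (by simpa using ENNReal.toReal_mono ENNReal.one_ne_top hβ1)
  rw [ENNReal.ofReal_toReal hαtop, hA, hmul hα hAtop] at hlow
  rw [ENNReal.ofReal_toReal hβtop, hB, hmul hβ hBtop] at hupp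
  have h1 : HasSeparatedDigits N (kappa D) (tau D) M (s ∘ φ) D := h.comp hφ id
  have h2 := h.comp hφ φ
  exact ⟨φ, hφ, ⟨h1.dimH_sumSet.trans hlow, h1.packingDim_sumSet.trans hupp⟩,
    h2.dimH_sumSet.trans hlow, h2.packingDim_sumSet.trans hupp⟩
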